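/- Let $\mathscr E=\{E_1,\dots,E_m\}$ be a POVM on $\mathscr H=\mathbb C^d$, $d\ge 1$ (that is, $E_k\ge 0$ and $\sum_k E_k=\mathbb 1$), and let $\mathscr S(\cdot)$ denote the set of density matrices. For states $\rho,\sigma\in\mathscr S(\mathscr H)$ put $P_k=\mathrm{tr}(E_k\rho)$, $\overline P_k=\mathrm{tr}(E_k\sigma)$ and $$\phi(s|P\|\overline P)=\log\sum_{k} P_k^{s}\,\overline P_k^{\,1-s}\in[-\infty,0],\qquad 0\le s\le 1,$$ where terms with $P_k=0$ or $\overline P_k=0$ are omitted (also for $s\in\{0,1\}$) and $\log 0=-\infty$. For a set $a\subseteq\{1,\dots,m\}^n$ of outcome sequences with complement $\bar a$ let $E^a=\sum_{(k_1,\dots,k_n)\in a}E_{k_1}\otimes\cdots\otimes E_{k_n}$. For $\rho^n,\sigma^n\in\mathscr S(\mathscr H^{\otimes n})$ let $$p_{\rm err}(\rho^n,\sigma^n)=\min_{a}\tfrac12\big(\mathrm{tr}(E^{\bar a}\rho^n)+\mathrm{tr}(E^{a}\sigma^n)\big),\qquad \tilde p_{\rm err}(\rho^n,\sigma^n)=\inf_{\mathscr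 M}\,p_{\rm err}(\mathscr M(\rho^n),\mathscr M(\sigma^n)),$$ where $\mathscr M$ runs over all completely positive trace-preserving maps on $\mathscr H^{\otimes n}$ (pre-processing; the choice of $a$ is the post-processing), and let $p^*_n=\inf_{(\rho^n,\sigma^n)}\tilde p_{\rm err}(\rho^n,\sigma^n)$, the infimum being over all pairs of $n$-partite states. In an adaptive protocol with $n$ measurements, at step $t=1,\dots,n$ a state of $\mathscr S(\mathscr H)$, which depends on the previous outcomes $k_1,\dots,k_{t-1}$ and on the hypothesis, is prepared, a completely positive trace-preserving map on $\mathscr H$, which depends on the previous outcomes only, is applied to it, and $\mathscr E$ is measured; finally the outcome sequences are grouped into $a$ (first hypothesis accepted) and $\bar a$ (second hypothesis accepted). Let $p^{\rm ad}_n$ be the infimum over all such protocols of the average of the two error probabilities. Then: 1. The minimum in $$\zeta_{\rm CB}:=-\min_{(\rho,\sigma)}\ \min_{0\le s\le 1}\phi(s|P\|\overline P)\in[0,\infty],$$ over pairs $\rho,\sigma\in\mathscr S(\mathscr H)$ and $s\in[0,1]$, is attained. 2. $\displaystyle\lim_{n\to\infty}-\frac1n\log p^*_n=\zeta_{\rm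 CB}$. 3. $\displaystyle-\min_{(\rho^n,\sigma^n)_n}\ \lim_{n\to\infty}\frac1n\log \tilde p_{\rm err}(\rho^n,\sigma^n)=\zeta_{\rm CB}$, where the minimum, which is attained, is over all sequences of state pairs for which the limit exists in $[-\infty,\infty]$. 4. I.i.d. state pairs are asymptotically optimal: for every pair $(\rho,\sigma)$ that attains the minimum in 1 (for some $s$), $\displaystyle\lim_{n\to\infty}-\frac1n\log p_{\rm err}(\rho^{\otimes n},\sigma^{\otimes n})=\zeta_{\rm CB}$, even without pre-processing. 5. Adaptive protocols do not improve the rate: $\displaystyle\lim_{n\to\infty}-\frac1n\log p^{\rm ad}_n=\zeta_{\rm CB}$. -/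

import Mathlib

open Filter Topology
open scoped Matrix ComplexOrder

noncomputable section

namespace DetectorDiscrimination

section Basic

variable {ι κ α β : Type*} [Fintype ι] [Fintype κ] [Fintype α] [Fintype β]

/-- A density matrix (quantum state) on the Hilbert space `ℂ^α`. -/
structure DensityMatrix (α : Type*) [Fintype α] where
  mat : Matrix α α ℂ
  posSemidef : mat.PosSemidef
  trace_eq_one : mat.trace = 1

/-- A POVM on the Hilbert space `ℂ^ι` with outcomes labelled by `κ`. -/
structure POVM (ι κ : Type*) [Fintype ι] [DecidableEq ι] [Fintype κ] where
  elem : κ → Matrix ι ι ℂ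
  posSemidef : ∀ k, (elem k).PosSemidef
  sum_eq_one : ∑ k, elem k = 1

/-- The ampliation `id_r ⊗ Φ` of a linear map `Φ` between matrix algebras, acting on
`r × r` block matrices block by block. -/
def ampliation (r : ℕ) (Φ : Matrix α α ℂ →ₗ[ℂ] Matrix β β ℂ)
    (X : Matrix (Fin r × α) (Fin r × α) ℂ) : Matrix (Fin r × β) (Fin r × β) ℂ :=
  Matrix.of fun p q => Φ (Matrix.of fun a b => X (p.1, a) (q.1, b)) p.2 q.2

/-- A trace preserving quantum operation: a completely positive and trace preserving linear map. -/
structure Channel (α β : Type*) [Fintype α] [Fintype β] where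
  toLin : Matrix α α ℂ →ₗ[ℂ] Matrix β β ℂ
  completelyPositive : ∀ (r : ℕ) (X : Matrix (Fin r × α) (Fin r × α) ℂ),
    X.PosSemidef → (ampliation r toLin X).PosSemidef
  tracePreserving : ∀ X, (toLin X).trace = X.trace

theorem Channel.posSemidef_map (Φ : Channel α β) {X : Matrix α α ℂ} (hX : X.PosSemidef) :
    (Φ.toLin X).PosSemidef := by
  have h := (Φ.completelyPositive 1 (X.submatrix Prod.snd Prod.snd) (hX.submatrix _)).submatrix
    (fun b : β => ((0 : Fin 1), b))
  exact h

/-- The state `Φ(ρ)`. -/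
def Channel.apply (Φ : Channel α β) (ρ : DensityMatrix α) : DensityMatrix β where
  mat := Φ.toLin ρ.mat
  posSemidef := Φ.posSemidef_map ρ.posSemidef
  trace_eq_one := (Φ.tracePreserving ρ.mat).trans ρ.trace_eq_one

/-- The operator `A₁ ⊗ ⋯ ⊗ Aₙ` on `(ℂ^ι)^{⊗ n} = ℂ^(Fin n → ι)`. -/
def tensorOp {n : ℕ} (A : Fin n → Matrix ι ι ℂ) : Matrix (Fin n → ι) (Fin n → ι) ℂ :=
  Matrix.of fun x y => ∏ i, A i (x i) (y i)

theorem tensorOp_mul [DecidableEq ι] {n : ℕ} (A B : Fin n → Matrix ι ι ℂ) :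
    tensorOp A * tensorOp B = tensorOp fun i => A i * B i := by
  ext x y
  simp only [tensorOp, Matrix.mul_apply, Matrix.of_apply, ← Finset.prod_mul_distrib]
  rw [Finset.prod_univ_sum, Fintype.piFinset_univ]

theorem tensorOp_conjTranspose {γ : Type*} {n : ℕ} (A : Fin n → Matrix γ γ ℂ) :
    (tensorOp A)ᴴ = tensorOp fun i => (A i)ᴴ := by
  ext x y
  simp [tensorOp, Matrix.conjTranspose_apply]

open scoped MatrixOrder Matrix.Norms.L2Operator in
theorem tensorOp_posSemidef [DecidableEq ι] {n : ℕ} {A : Fin n → Matrix ι ι ℂ}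
    (hA : ∀ i, (A i).PosSemidef) : (tensorOp A).PosSemidef := by
  have h : ∀ i, ∃ B : Matrix ι ι ℂ, A i = Bᴴ * B := fun i =>
    CStarAlgebra.nonneg_iff_eq_star_mul_self.mp (Matrix.nonneg_iff_posSemidef.mpr (hA i))
  choose B hB using h
  have : tensorOp A = (tensorOp B)ᴴ * tensorOp B := by
    rw [tensorOp_conjTranspose, tensorOp_mul]
    congr 1
    funext i
    exact hB i
  rw [this]
  exact Matrix.posSemidef_conjTranspose_mul_self _

theorem tensorOp_trace [DecidableEq ι] {n : ℕ} (A : Fin n → Matrix ι ι ℂ) :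
    (tensorOp A).trace = ∏ i, (A i).trace := by
  simp only [tensorOp, Matrix.trace, Matrix.diag, Matrix.of_apply]
  rw [Finset.prod_univ_sum, Fintype.piFinset_univ]

/-- The i.i.d. state `ρ^{⊗ n}`. -/
def DensityMatrix.tensorPow [DecidableEq ι] (ρ : DensityMatrix ι) (n : ℕ) :
    DensityMatrix (Fin n → ι) where
  mat := tensorOp fun _ => ρ.mat
  posSemidef := tensorOp_posSemidef fun _ => ρ.posSemidef
  trace_eq_one := by simp [tensorOp_trace, ρ.trace_eq_one]

end Basic

section Fixed

variable {ι κ : Type*} [Fintype ι] [DecidableEq ι] [Fintype κ] [DecidableEq κ]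

/-- Outcome distribution of one measurement: `P_k = tr (E_k ρ)`. -/
def POVM.prob (E : POVM ι κ) (ρ : DensityMatrix ι) (k : κ) : ℝ :=
  (E.elem k * ρ.mat).trace.re

/-- `E^a = ∑_{k ∈ a} E_{k₁} ⊗ ⋯ ⊗ E_{kₙ}` for a set `a` of outcome sequences of length `n`. -/
def POVM.grouping (E : POVM ι κ) {n : ℕ} (a : Finset (Fin n → κ)) :
    Matrix (Fin n → ι) (Fin n → ι) ℂ :=
  ∑ k ∈ a, tensorOp fun i => E.elem (k i)

/-- Type-I error `tr (E^ā ρⁿ)`; the sequences in `a` are assigned to the null hypothesis. -/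
def typeIError (E : POVM ι κ) {n : ℕ} (a : Finset (Fin n → κ))
    (ρ : DensityMatrix (Fin n → ι)) : ℝ :=
  (E.grouping aᶜ * ρ.mat).trace.re

/-- Type-II error `tr (E^a σⁿ)`. -/
def typeIIError (E : POVM ι κ) {n : ℕ} (a : Finset (Fin n → κ))
    (σ : DensityMatrix (Fin n → ι)) : ℝ :=
  (E.grouping a * σ.mat).trace.re

/-- Symmetric error for the input pair `(ρⁿ, σⁿ)`, minimized over post-processing. -/
def pErr (E : POVM ι κ) {n : ℕ} (ρ σ : DensityMatrix (Fin n → ι)) : ℝ :=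
  ⨅ a : Finset (Fin n → κ), (typeIError E a ρ + typeIIError E a σ) / 2

/-- Symmetric error for the input pair `(ρⁿ, σⁿ)`, minimized over pre- and post-processing. -/
def pErrPre (E : POVM ι κ) {n : ℕ} (ρ σ : DensityMatrix (Fin n → ι)) : ℝ :=
  ⨅ Φ : Channel (Fin n → ι) (Fin n → ι), pErr E (Φ.apply ρ) (Φ.apply σ)

/-- Symmetric error minimized over all pairs of `n`-partite input states, and over pre- and
post-processing. -/
def pErrOpt (E : POVM ι κ) (n : ℕ) : ℝ :=
  ⨅ p : DensityMatrix (Fin n → ι) × DensityMatrix (Fin n → ι), pErrPre E p.1 p.2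

/-- An object of type `T` chosen at each of `n` steps as a function of the outcomes of the
previous steps. -/
def Feedback (κ : Type*) (n : ℕ) (T : Type*) : Type _ :=
  (s : Fin n) → (Fin s → κ) → T

/-- Probability of the outcome sequence `k` when at step `s` the state prepared is `ρ s (k₁, …)`,
the operation `Φ s (k₁, …)` is applied to it, and then `E` is measured. -/
def adaptiveProb (E : POVM ι κ) {n : ℕ} (Φ : Feedback κ n (Channel ι ι))
    (ρ : Feedback κ n (DensityMatrix ι)) (k : Fin n → κ) : ℝ :=
  ∏ s : Fin n, E.prob
    ((Φ s fun i => k (i.castLE s.isLt.le)).apply (ρ s fun i => k (i.castLE s.isLt.le))) (k s)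

/-- Symmetric error of an adaptive protocol with decision set `a` for the null hypothesis. -/
def adaptiveErr (E : POVM ι κ) {n : ℕ} (Φ : Feedback κ n (Channel ι ι))
    (ρ σ : Feedback κ n (DensityMatrix ι)) (a : Finset (Fin n → κ)) : ℝ :=
  (∑ k ∈ aᶜ, adaptiveProb E Φ ρ k + ∑ k ∈ a, adaptiveProb E Φ σ k) / 2

/-- Symmetric error minimized over all adaptive protocols with `n` measurements. -/
def adaptiveErrOpt (E : POVM ι κ) (n : ℕ) : ℝ :=
  ⨅ p : (Feedback κ n (DensityMatrix ι) × Feedback κ n (DensityMatrix ι)) ×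
      Feedback κ n (Channel ι ι) × Finset (Fin n → κ),
    adaptiveErr E p.2.1 p.1.1 p.1.2 p.2.2

/-- Logarithm of a nonnegative real, with `log 0 = -∞`. -/
def elog (x : ℝ) : EReal := ENNReal.log (ENNReal.ofReal x)

/-- `φ(s | P ‖ Q) = log ∑_k P_k^s Q_k^{1-s}`, where terms with `P_k = 0` or `Q_k = 0` vanish also
for `s = 0` and `s = 1` (so that the expression is continuous in `s ∈ [0, 1]`). -/
def phi (s : ℝ) (P Q : κ → ℝ) : EReal :=
  elog (∑ k with 0 < P k ∧ 0 < Q k, P k ^ s * Q k ^ (1 - s))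

/-- All values `φ(s | P ‖ P̄)` with `P_k = tr (E_k ρ)`, `P̄_k = tr (E_k σ)`, `0 ≤ s ≤ 1`. -/
def chernoffValues (E : POVM ι κ) : Set EReal :=
  {x | ∃ (ρ σ : DensityMatrix ι) (s : ℝ), s ∈ Set.Icc (0 : ℝ) 1 ∧ x = phi s (E.prob ρ) (E.prob σ)}

/-- `ζ_CB = - min_{(ρ, σ)} min_{0 ≤ s ≤ 1} φ(s | P ‖ P̄)`. -/
def zetaCB (E : POVM ι κ) : EReal := -sInf (chernoffValues E)

end Fixed

end DetectorDiscrimination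

end

open DetectorDiscrimination

/-! The problem reduces to classical statistics. One measurement yields a distribution in the
compact set `Set.range E.prob`, and a symmetric error minimized over decisions is half the overlap
`∑ min (p, q)` of the two sequence distributions. Both an arbitrary `n`-partite state and an
adaptive protocol give sequence distributions whose conditional factors lie in this set
(`isAdapted_seqProb`, `isAdapted_adaptiveProb`), so one converse for adapted pairs covers
entanglement, pre-processing and feedback alike.

Achievability is `min a b ≤ a ^ s * b ^ (1 - s)` on i.i.d. inputs (`sum_min_prod_le`).

For the converse (`exists_le_sum_min`), let all Chernoff coefficients be at least `exp (-z)`. Each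
pair `P, Q` then has a tilted distribution `R` with relative entropy at most `z` to both
(`exists_intermediate_entropy_le`). For small `t` the moments of `R / P` and `R / Q` under `R` are
at most `exp (t * (z + δ))`, uniformly in the pair by compactness (`exists_forall_moment_le`). These
bounds multiply along the steps, and Jensen converts them into an overlap of at least `c * exp (-(n
* (z + δ)))` with `c` independent of `n`. If the optimal coefficient is zero, no converse is needed.
-/

open DetectorDiscrimination

namespace DetectorDiscrimination

/-! ### Tilted distributions and uniform one-step moment bounds -/

section Classical

variable {κ : Type*} [Fintype κ]

/-- The Chernoff coefficient `∑_k P_k^s Q_k^{1-s}`, summed over the common support. -/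
noncomputable def chernoffSum (s : ℝ) (P Q : κ → ℝ) : ℝ :=
  ∑ k with 0 < P k ∧ 0 < Q k, P k ^ s * Q k ^ (1 - s)

theorem hasDerivAt_chernoffSum (P Q : κ → ℝ) (s : ℝ) :
    HasDerivAt (fun s => chernoffSum s P Q)
      (∑ k with 0 < P k ∧ 0 < Q k,
        P k ^ s * Q k ^ (1 - s) * (Real.log (P k) - Real.log (Q k))) s := by
  unfold chernoffSum
  refine HasDerivAt.fun_sum fun k hk => ?_
  obtain ⟨hP, hQ⟩ := (Finset.mem_filter.mp hk).2
  have h1 : HasDerivAt (fun s : ℝ => P k ^ s) (P k ^ s * Real.log (P k)) s := by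
    simpa [mul_comm] using (hasDerivAt_id s).const_rpow hP
  have h2 : HasDerivAt (fun s : ℝ => Q k ^ (1 - s)) (-(Q k ^ (1 - s) * Real.log (Q k))) s := by
    simpa [mul_comm] using ((hasDerivAt_id s).const_sub 1).const_rpow hQ
  exact (h1.mul h2).congr_deriv (by ring)

/-- `R` is a probability vector supported on the common support of `P` and `Q`. -/
structure IsIntermediate (R P Q : κ → ℝ) : Prop where
  nonneg : ∀ k, 0 ≤ R k
  sum_eq_one : ∑ k, R k = 1
  pos_left : ∀ k, R k ≠ 0 → 0 < P k
  pos_right : ∀ k, R k ≠ 0 → 0 < Q k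

/-- The tilted distribution at a minimizer of the Chernoff coefficient has relative entropy at
most the Chernoff distance to both distributions. -/
theorem exists_intermediate_entropy_le {P Q : κ → ℝ} {z : ℝ}
    (h : ∀ s ∈ Set.Icc (0 : ℝ) 1, Real.exp (-z) ≤ chernoffSum s P Q) :
    ∃ R, IsIntermediate R P Q ∧ ∑ k, R k * Real.log (R k / P k) ≤ z ∧
      ∑ k, R k * Real.log (R k / Q k) ≤ z := by
  classical
  obtain ⟨s, hs, hmin⟩ := (isCompact_Icc (a := (0 : ℝ)) (b := 1)).exists_isMinOn ⟨0, by simp⟩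
    (f := fun s => chernoffSum s P Q)
    (fun s _ => (hasDerivAt_chernoffSum P Q s).continuousAt.continuousWithinAt)
  set S : Finset κ := {k | 0 < P k ∧ 0 < Q k} with hS
  set D := ∑ k ∈ S, P k ^ s * Q k ^ (1 - s) * (Real.log (P k) - Real.log (Q k)) with hD
  have hder := hasDerivAt_chernoffSum P Q s
  -- First-order optimality on an interval; the inequality form also covers minimizers at `s = 0`
  -- and `s = 1`, where `D` need not vanish.
  have hvar : ∀ u ∈ Set.Icc (0 : ℝ) 1, 0 ≤ (u - s) * D := by
    intro u hu
    have := hmin.localize.hasFDerivWithinAt_nonneg hder.hasFDerivAt.hasFDerivWithinAt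
      (y := u - s) (mem_posTangentConeAt_of_segment_subset (by
        rw [add_sub_cancel]
        exact (convex_Icc (0 : ℝ) 1).segment_subset hs hu))
    simpa using this
  set Z := chernoffSum s P Q with hZ
  have hZc : Real.exp (-z) ≤ Z := h s hs
  have hZ0 : 0 < Z := (Real.exp_pos _).trans_le hZc
  have hlogZ : -Real.log Z ≤ z := by
    have := Real.log_le_log (Real.exp_pos _) hZc
    rw [Real.log_exp] at this
    linarith
  have hmem : ∀ k, k ∈ S ↔ 0 < P k ∧ 0 < Q k := fun k => by simp [hS]
  have hsum : ∑ k ∈ S, P k ^ s * Q k ^ (1 - s) / Z = 1 := by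
    rw [← Finset.sum_div]
    exact div_self hZ0.ne'
  have hne : ∀ k, (if k ∈ S then P k ^ s * Q k ^ (1 - s) / Z else 0) ≠ 0 → k ∈ S := by
    intro k hk
    by_contra hkS
    simp [hkS] at hk
  have hlogR : ∀ k ∈ S, Real.log (P k ^ s * Q k ^ (1 - s) / Z)
      = s * Real.log (P k) + (1 - s) * Real.log (Q k) - Real.log Z := by
    intro k hk
    obtain ⟨hP, hQ⟩ := (hmem k).1 hk
    rw [Real.log_div (by positivity) hZ0.ne', Real.log_mul (by positivity) (by positivity),
      Real.log_rpow hP, Real.log_rpow hQ]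
  -- Both entropies have this form: `a = s - 1` for `P` and `a = s` for `Q`. By `hvar` at `u = 1`
  -- and `u = 0`, the `D` term is nonpositive in both cases.
  have hent : ∀ a : ℝ, ∑ k ∈ S, P k ^ s * Q k ^ (1 - s) / Z *
      (a * (Real.log (P k) - Real.log (Q k)) - Real.log Z) = a * D / Z - Real.log Z := by
    intro a
    calc _ = ∑ k ∈ S, (a / Z * (P k ^ s * Q k ^ (1 - s) * (Real.log (P k) - Real.log (Q k)))
          - Real.log Z * (P k ^ s * Q k ^ (1 - s) / Z)) :=
            Finset.sum_congr rfl fun k _ => by ring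
      _ = _ := by
        rw [Finset.sum_sub_distrib, ← Finset.mul_sum, ← Finset.mul_sum, hsum, ← hD]
        ring
  refine ⟨fun k => if k ∈ S then P k ^ s * Q k ^ (1 - s) / Z else 0, ⟨?_, ?_, ?_, ?_⟩, ?_, ?_⟩
  · intro k
    split_ifs with hk
    · obtain ⟨hP, hQ⟩ := (hmem k).1 hk
      positivity
    · exact le_rfl
  · rw [Finset.sum_ite_mem, Finset.univ_inter, hsum]
  · exact fun k hk => ((hmem k).1 (hne k hk)).1
  · exact fun k hk => ((hmem k).1 (hne k hk)).2
  · simp only [ite_mul, zero_mul]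
    rw [Finset.sum_ite_mem, Finset.univ_inter]
    calc _ = ∑ k ∈ S, P k ^ s * Q k ^ (1 - s) / Z *
          ((s - 1) * (Real.log (P k) - Real.log (Q k)) - Real.log Z) := by
          refine Finset.sum_congr rfl fun k hk => ?_
          obtain ⟨hP, hQ⟩ := (hmem k).1 hk
          rw [if_pos hk, Real.log_div (by positivity) hP.ne', hlogR k hk]
          ring
      _ = (s - 1) * D / Z - Real.log Z := hent _
      _ ≤ z := by
        have h1 := hvar 1 (by simp)
        have : (s - 1) * D / Z ≤ 0 := div_nonpos_of_nonpos_of_nonneg (by linarith) hZ0.le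
        linarith
  · simp only [ite_mul, zero_mul]
    rw [Finset.sum_ite_mem, Finset.univ_inter]
    calc _ = ∑ k ∈ S, P k ^ s * Q k ^ (1 - s) / Z *
          (s * (Real.log (P k) - Real.log (Q k)) - Real.log Z) := by
          refine Finset.sum_congr rfl fun k hk => ?_
          obtain ⟨hP, hQ⟩ := (hmem k).1 hk
          rw [if_pos hk, Real.log_div (by positivity) hQ.ne', hlogR k hk]
          ring
      _ = s * D / Z - Real.log Z := hent _
      _ ≤ z := by
        have h1 := hvar 0 (by simp)
        have : s * D / Z ≤ 0 := div_nonpos_of_nonpos_of_nonneg (by linarith) hZ0.le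
        linarith

/-- The moments `∑_k R_k (R_k / P_k)^t` are governed to first order by the relative entropy. -/
theorem eventually_moment_lt {R P : κ → ℝ} (hR : ∀ k, 0 ≤ R k) (hsum : ∑ k, R k = 1)
    (hP : ∀ k, R k ≠ 0 → 0 < P k) {y : ℝ} (h : ∑ k, R k * Real.log (R k / P k) < y) :
    ∀ᶠ t in 𝓝[>] (0 : ℝ), ∑ k, R k * (R k / P k) ^ t < Real.exp (t * y) := by
  -- The difference vanishes at `t = 0` and has negative derivative there.
  have hd : HasDerivAt (fun t : ℝ => ∑ k, R k * (R k / P k) ^ t - Real.exp (t * y))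
      (∑ k, R k * Real.log (R k / P k) - y) 0 := by
    refine HasDerivAt.sub (HasDerivAt.fun_sum fun k _ => ?_) ?_
    · by_cases hk : R k = 0
      · simpa [hk] using hasDerivAt_const (0 : ℝ) (0 : ℝ)
      · have h0 : 0 < R k / P k := div_pos ((hR k).lt_of_ne' hk) (hP k hk)
        simpa using ((hasDerivAt_id (0 : ℝ)).const_rpow h0).const_mul (R k)
    · simpa using ((hasDerivAt_id (0 : ℝ)).mul_const y).exp
  filter_upwards [hd.tendsto_slope_zero_right.eventually (gt_mem_nhds (sub_neg.mpr h)),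
    self_mem_nhdsWithin] with t ht (ht0 : 0 < t)
  simp only [zero_add, Real.rpow_zero, mul_one, hsum, zero_mul, Real.exp_zero, sub_self,
    sub_zero, smul_eq_mul] at ht
  have := neg_of_mul_neg_right ht (inv_pos.mpr ht0).le
  linarith

/-- Monotonicity of power means: a bound at one exponent `u` yields all smaller positive exponents,
so only one exponent has to be controlled near each pair. -/
theorem moment_le_of_le {R P : κ → ℝ} (hR : ∀ k, 0 ≤ R k) (hsum : ∑ k, R k = 1)
    (hP : ∀ k, R k ≠ 0 → 0 < P k) {y t u : ℝ} (ht : 0 < t) (htu : t ≤ u)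
    (h : ∑ k, R k * (R k / P k) ^ u ≤ Real.exp (u * y)) :
    ∑ k, R k * (R k / P k) ^ t ≤ Real.exp (t * y) := by
  set P' : κ → ℝ := fun k => if R k = 0 then 1 else P k with hP'
  have hP'0 : ∀ k, 0 ≤ R k / P' k := by
    intro k
    by_cases hk : R k = 0
    · simp [hk]
    · simpa [hP', hk] using div_nonneg (hR k) (hP k hk).le
  have hPP : ∀ v : ℝ, ∑ k, R k * (R k / P k) ^ v = ∑ k, R k * (R k / P' k) ^ v := by
    intro v
    refine Finset.sum_congr rfl fun k _ => ?_
    by_cases hk : R k = 0 <;> simp [hP', hk]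
  rw [hPP] at h ⊢
  have hu : 0 < u := ht.trans_le htu
  have hJ := Real.rpow_arith_mean_le_arith_mean_rpow Finset.univ R (fun k => (R k / P' k) ^ t)
    (fun k _ => hR k) hsum (fun k _ => Real.rpow_nonneg (hP'0 k) _) (p := u / t)
    ((one_le_div ht).mpr htu)
  have hX : 0 ≤ ∑ k, R k * (R k / P' k) ^ t :=
    Finset.sum_nonneg fun k _ => mul_nonneg (hR k) (Real.rpow_nonneg (hP'0 k) _)
  have hpow : ∀ k, ((R k / P' k) ^ t) ^ (u / t) = (R k / P' k) ^ u := by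
    intro k
    rw [← Real.rpow_mul (hP'0 k), mul_div_cancel₀ u ht.ne']
  simp only [hpow] at hJ
  have h2 := Real.rpow_le_rpow (Real.rpow_nonneg hX _) (hJ.trans h) (z := t / u) (by positivity)
  rw [← Real.rpow_mul hX, ← Real.exp_mul] at h2
  rwa [show u / t * (t / u) = 1 by field_simp, Real.rpow_one,
    show u * y * (t / u) = t * y by field_simp] at h2

/-- Terms off the support of `R` vanish identically, so zeros of `P` there do no harm. This lets an
`R` chosen for one pair serve all nearby pairs. -/
theorem continuousAt_moment {R P : κ → ℝ} (hR : ∀ k, 0 ≤ R k) (hP : ∀ k, R k ≠ 0 → 0 < P k)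
    {t : ℝ} : ContinuousAt (fun P : κ → ℝ => ∑ k, R k * (R k / P k) ^ t) P := by
  refine tendsto_finsetSum _ fun k _ => ?_
  by_cases hk : R k = 0
  · simp [hk]
  · have h0 : 0 < R k / P k := div_pos ((hR k).lt_of_ne' hk) (hP k hk)
    have h1 : ContinuousAt (fun P : κ → ℝ => R k / P k) P :=
      continuousAt_const.div (continuous_apply k).continuousAt (hP k hk).ne'
    exact (h1.rpow_const (Or.inl h0.ne')).const_mul _

/-- A one-step bound that is uniform over a compact set of pairs of distributions. -/
theorem exists_forall_moment_le {K : Set (κ → ℝ)} (hK : IsCompact K) {z δ : ℝ} (hδ : 0 < δ)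
    (h : ∀ P ∈ K, ∀ Q ∈ K, ∀ s ∈ Set.Icc (0 : ℝ) 1, Real.exp (-z) ≤ chernoffSum s P Q) :
    ∃ u : ℝ, 0 < u ∧ ∀ t, 0 < t → t ≤ u → ∀ P ∈ K, ∀ Q ∈ K, ∃ R, IsIntermediate R P Q ∧
      ∑ k, R k * (R k / P k) ^ t ≤ Real.exp (t * (z + δ)) ∧
      ∑ k, R k * (R k / Q k) ^ t ≤ Real.exp (t * (z + δ)) := by
  suffices H : ∃ u : ℝ, 0 < u ∧ ∀ t, 0 < t → t ≤ u → ∀ x ∈ K ×ˢ K, ∃ R,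
      IsIntermediate R x.1 x.2 ∧
      ∑ k, R k * (R k / x.1 k) ^ t ≤ Real.exp (t * (z + δ)) ∧
      ∑ k, R k * (R k / x.2 k) ^ t ≤ Real.exp (t * (z + δ)) by
    obtain ⟨u, hu, H⟩ := H
    exact ⟨u, hu, fun t ht htu P hP Q hQ => H t ht htu (P, Q) ⟨hP, hQ⟩⟩
  -- Compactness induction: the property passes to subsets and finite unions (smaller `u`), so it
  -- suffices to find it near each pair.
  refine (hK.prod hK).induction_on (p := fun S => ∃ u : ℝ, 0 < u ∧ ∀ t, 0 < t → t ≤ u →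
    ∀ x ∈ S, ∃ R, IsIntermediate R x.1 x.2 ∧
      ∑ k, R k * (R k / x.1 k) ^ t ≤ Real.exp (t * (z + δ)) ∧
      ∑ k, R k * (R k / x.2 k) ^ t ≤ Real.exp (t * (z + δ))) ?_ ?_ ?_ ?_
  · exact ⟨1, one_pos, by simp⟩
  · rintro S T hST ⟨u, hu, H⟩
    exact ⟨u, hu, fun t ht htu x hx => H t ht htu x (hST hx)⟩
  · rintro S T ⟨u, hu, H⟩ ⟨v, hv, H'⟩
    refine ⟨min u v, lt_min hu hv, fun t ht htu x hx => ?_⟩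
    rcases hx with hx | hx
    · exact H t ht (htu.trans (min_le_left _ _)) x hx
    · exact H' t ht (htu.trans (min_le_right _ _)) x hx
  · rintro ⟨P₀, Q₀⟩ ⟨hP₀, hQ₀⟩
    obtain ⟨R, hR, hRP, hRQ⟩ := exists_intermediate_entropy_le (h P₀ hP₀ Q₀ hQ₀)
    have e1 := eventually_moment_lt hR.nonneg hR.sum_eq_one hR.pos_left (y := z + δ) (by linarith)
    have e2 := eventually_moment_lt hR.nonneg hR.sum_eq_one hR.pos_right (y := z + δ) (by linarith)
    obtain ⟨u, ⟨hu1, hu2⟩, hu⟩ := ((e1.and e2).and self_mem_nhdsWithin).exists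
    have c1 := (continuousAt_moment hR.nonneg hR.pos_left (t := u)).eventually (gt_mem_nhds hu1)
    have c2 := (continuousAt_moment hR.nonneg hR.pos_right (t := u)).eventually (gt_mem_nhds hu2)
    have d : ∀ P : κ → ℝ, (∀ k, R k ≠ 0 → 0 < P k) →
        ∀ᶠ P' in 𝓝 P, ∀ k, R k ≠ 0 → 0 < P' k := by
      intro P hP
      refine eventually_all.mpr fun k => ?_
      by_cases hk : R k = 0
      · simp [hk]
      · filter_upwards [(continuous_apply k).continuousAt.eventually (lt_mem_nhds (hP k hk))]
          with P' hP' _ using hP'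
    refine ⟨_, mem_nhdsWithin_of_mem_nhds (prod_mem_nhds (c1.and (d P₀ hR.pos_left))
      (c2.and (d Q₀ hR.pos_right))), u, hu, ?_⟩
    rintro t ht htu ⟨P, Q⟩ ⟨⟨hP1, hP2⟩, hQ1, hQ2⟩
    exact ⟨R, ⟨hR.nonneg, hR.sum_eq_one, hP2, hQ2⟩,
      moment_le_of_le hR.nonneg hR.sum_eq_one hP2 ht htu hP1.le,
      moment_le_of_le hR.nonneg hR.sum_eq_one hQ2 ht htu hQ1.le⟩

end Classical

/-! ### Adapted distributions and the converse bound on the overlap -/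

section Adapted

variable {κ : Type*}

/-- Functions `p` of the form `p (k₁, …, kₙ) = ∏ₜ P_{k₁, …, kₜ₋₁} (kₜ)`, where each
`P_{k₁, …, kₜ₋₁}` belongs to `K`. -/
def IsAdapted (K : Set (κ → ℝ)) : (n : ℕ) → ((Fin n → κ) → ℝ) → Prop
  | 0, p => ∀ k, p k = 1
  | n + 1, p => ∃ P ∈ K, ∃ r : κ → (Fin n → κ) → ℝ, ∀ k, IsAdapted K n (r k) ∧
      ∀ h, p (Fin.cons k h) = P k * r k h

theorem IsAdapted.nonneg {K : Set (κ → ℝ)} (hK : ∀ P ∈ K, ∀ k, 0 ≤ P k) :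
    ∀ {n : ℕ} {p : (Fin n → κ) → ℝ}, IsAdapted K n p → ∀ k, 0 ≤ p k
  | 0, p, hp, k => by rw [hp k]; exact zero_le_one
  | n + 1, p, hp, k => by
    obtain ⟨P, hP, r, hr⟩ := hp
    rw [← Fin.cons_self_tail k, (hr _).2]
    exact mul_nonneg (hK P hP _) (IsAdapted.nonneg hK (hr _).1 _)

theorem sum_fin_succ_arrow [Fintype κ] {M : Type*} [AddCommMonoid M] {n : ℕ}
    (f : (Fin (n + 1) → κ) → M) :
    ∑ k, f k = ∑ a : κ, ∑ h : Fin n → κ, f (Fin.cons a h) := by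
  rw [← Fintype.sum_prod_type' fun (a : κ) (h : Fin n → κ) => f (Fin.cons a h)]
  exact (Fintype.sum_equiv (Fin.consEquiv fun _ => κ) _ _ fun _ => rfl).symm

variable [Fintype κ]

/-- Gluing a one-step `R` to intermediate distributions of the continuations makes each moment a
first-step moment weighted by continuation moments, so every step costs a factor `B`. Different
outcomes may have unrelated continuations. -/
theorem IsAdapted.exists_intermediate {K : Set (κ → ℝ)} (hK0 : ∀ P ∈ K, ∀ k, 0 ≤ P k) {t B : ℝ}
    (hB : 0 ≤ B)
    (hK : ∀ P ∈ K, ∀ Q ∈ K, ∃ R, IsIntermediate R P Q ∧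
      ∑ k, R k * (R k / P k) ^ t ≤ B ∧ ∑ k, R k * (R k / Q k) ^ t ≤ B) :
    ∀ {n : ℕ} {p q : (Fin n → κ) → ℝ}, IsAdapted K n p → IsAdapted K n q →
      ∃ R : (Fin n → κ) → ℝ, (∀ k, 0 ≤ R k) ∧ ∑ k, R k = 1 ∧
        (∀ k, R k ≠ 0 → 0 < p k ∧ 0 < q k) ∧
        ∑ k, R k * (R k / p k) ^ t ≤ B ^ n ∧ ∑ k, R k * (R k / q k) ^ t ≤ B ^ n
  | 0, p, q, hp, hq => by
    have hp' : p = fun _ => 1 := funext hp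
    have hq' : q = fun _ => 1 := funext hq
    subst hp' hq'
    exact ⟨fun _ => 1, by simp, by simp, by simp, by simp, by simp⟩
  | n + 1, p, q, hp, hq => by
    obtain ⟨P, hP, r, hr⟩ := hp
    obtain ⟨Q, hQ, w, hw⟩ := hq
    obtain ⟨R, hR, hRP, hRQ⟩ := hK P hP Q hQ
    choose T hT0 hT1 hTs hTr hTw using fun k =>
      IsAdapted.exists_intermediate hK0 hB hK (hr k).1 (hw k).1
    have key : ∀ (P : κ → ℝ) (r : κ → (Fin n → κ) → ℝ) (p : (Fin (n + 1) → κ) → ℝ),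
        (∀ k, 0 ≤ P k) → (∀ k h, 0 ≤ r k h) → (∀ k h, p (Fin.cons k h) = P k * r k h) →
        (∀ k, ∑ h, T k h * (T k h / r k h) ^ t ≤ B ^ n) →
        ∑ k, R k * (R k / P k) ^ t ≤ B →
        ∑ k : Fin (n + 1) → κ, (R (k 0) * T (k 0) (Fin.tail k)) *
          ((R (k 0) * T (k 0) (Fin.tail k)) / p k) ^ t ≤ B ^ (n + 1) := by
      intro P r p hP hr hp hT hRP
      rw [sum_fin_succ_arrow]
      simp only [Fin.cons_zero, Fin.tail_cons, hp]
      calc _ = ∑ a, (R a * (R a / P a) ^ t) * ∑ h, T a h * (T a h / r a h) ^ t := by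
            refine Finset.sum_congr rfl fun a _ => ?_
            rw [Finset.mul_sum]
            refine Finset.sum_congr rfl fun h _ => ?_
            rw [mul_div_mul_comm, Real.mul_rpow (div_nonneg (hR.nonneg a) (hP a))
              (div_nonneg (hT0 a h) (hr a h))]
            ring
        _ ≤ ∑ a, (R a * (R a / P a) ^ t) * B ^ n :=
            Finset.sum_le_sum fun a _ => mul_le_mul_of_nonneg_left (hT a)
              (mul_nonneg (hR.nonneg a)
                (Real.rpow_nonneg (div_nonneg (hR.nonneg a) (hP a)) _))
        _ ≤ B ^ (n + 1) := by
            rw [← Finset.sum_mul, pow_succ']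
            exact mul_le_mul_of_nonneg_right hRP (pow_nonneg hB n)
    refine ⟨fun k => R (k 0) * T (k 0) (Fin.tail k),
      fun k => mul_nonneg (hR.nonneg _) (hT0 _ _), ?_, ?_,
      key P r p (hK0 P hP) (fun k => (hr k).1.nonneg hK0) (fun k => (hr k).2) hTr hRP,
      key Q w q (hK0 Q hQ) (fun k => (hw k).1.nonneg hK0) (fun k => (hw k).2) hTw hRQ⟩
    · rw [sum_fin_succ_arrow]
      simp only [Fin.cons_zero, Fin.tail_cons, ← Finset.mul_sum, hT1, mul_one, hR.sum_eq_one]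
    · intro k hk
      have h1 := left_ne_zero_of_mul hk
      have h2 := hTs _ _ (right_ne_zero_of_mul hk)
      rw [← Fin.cons_self_tail k, (hr _).2, (hw _).2]
      exact ⟨mul_pos (hR.pos_left _ h1) h2.1, mul_pos (hR.pos_right _ h1) h2.2⟩

/-- A lower bound on the overlap `∑ min (p, q)` in terms of moments of an intermediate
distribution. -/
theorem le_sum_min_of_moment_le {τ : Type*} [Fintype τ] {R p q : τ → ℝ} (hp : ∀ k, 0 ≤ p k)
    (hq : ∀ k, 0 ≤ q k) (hR : ∀ k, 0 ≤ R k) (hsum : ∑ k, R k = 1)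
    (hpos : ∀ k, R k ≠ 0 → 0 < p k ∧ 0 < q k) {N : ℕ} (hN : N ≠ 0) {B : ℝ}
    (h1 : ∑ k, R k * (R k / p k) ^ ((N : ℝ)⁻¹) ≤ B)
    (h2 : ∑ k, R k * (R k / q k) ^ ((N : ℝ)⁻¹) ≤ B) :
    ((2 * B) ^ N)⁻¹ ≤ ∑ k, min (p k) (q k) := by
  classical
  set S : Finset τ := {k | R k ≠ 0} with hS
  have hRS : ∀ k ∈ S, 0 < R k ∧ 0 < p k ∧ 0 < q k := fun k hk =>
    have h := (Finset.mem_filter.mp hk).2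
    ⟨(hR k).lt_of_ne' h, hpos k h⟩
  -- On the support of `R`, `R / X` is exactly `min (p, q)`.
  set X : τ → ℝ := fun k => max (R k / p k) (R k / q k) with hX
  have hX0 : ∀ k ∈ S, 0 < X k := fun k hk =>
    lt_max_of_lt_left (div_pos (hRS k hk).1 (hRS k hk).2.1)
  have hR1 : ∑ k ∈ S, R k = 1 := by
    rw [hS, Finset.sum_filter_ne_zero, hsum]
  -- Jensen for `x ↦ x ^ (-N)` at the points `X ^ (1 / N)`, which bounds the mean of `X⁻¹` from
  -- below by a moment of small order.
  have hJ := (convexOn_zpow (𝕜 := ℝ) (-(N : ℤ))).map_sum_le (t := S) (w := R)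
    (p := fun k => X k ^ ((N : ℝ)⁻¹)) (fun k _ => hR k) hR1
    (fun k hk => Real.rpow_pos_of_pos (hX0 k hk) _)
  simp only [smul_eq_mul, zpow_neg, zpow_natCast] at hJ
  have hle : ∑ k ∈ S, R k * X k ^ ((N : ℝ)⁻¹) ≤ 2 * B := by
    calc _ ≤ ∑ k ∈ S, (R k * (R k / p k) ^ ((N : ℝ)⁻¹) + R k * (R k / q k) ^ ((N : ℝ)⁻¹)) := by
          refine Finset.sum_le_sum fun k hk => ?_
          obtain ⟨a, b, c⟩ := hRS k hk
          rw [← mul_add]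
          refine mul_le_mul_of_nonneg_left ?_ a.le
          rcases max_cases (R k / p k) (R k / q k) with h | h <;> simp only [hX, h.1]
          · exact le_add_of_nonneg_right (by positivity)
          · exact le_add_of_nonneg_left (by positivity)
      _ ≤ ∑ k, (R k * (R k / p k) ^ ((N : ℝ)⁻¹) + R k * (R k / q k) ^ ((N : ℝ)⁻¹)) := by
          refine Finset.sum_le_sum_of_subset_of_nonneg (Finset.subset_univ _) fun k _ _ => ?_
          have := hR k
          have := hp k
          have := hq k
          positivity
      _ ≤ 2 * B := by
          rw [Finset.sum_add_distrib]
          linarith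
  have hpos' : 0 < ∑ k ∈ S, R k * X k ^ ((N : ℝ)⁻¹) := by
    refine Finset.sum_pos (fun k hk => mul_pos (hRS k hk).1 (Real.rpow_pos_of_pos (hX0 k hk) _)) ?_
    by_contra hne
    rw [Finset.not_nonempty_iff_eq_empty] at hne
    simp [hne] at hR1
  calc ((2 * B) ^ N)⁻¹ ≤ ((∑ k ∈ S, R k * X k ^ ((N : ℝ)⁻¹)) ^ N)⁻¹ :=
        inv_anti₀ (by positivity) (pow_le_pow_left₀ hpos'.le hle N)
    _ ≤ ∑ k ∈ S, R k * ((X k ^ ((N : ℝ)⁻¹)) ^ N)⁻¹ := hJ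
    _ ≤ ∑ k ∈ S, min (p k) (q k) := by
        refine Finset.sum_le_sum fun k hk => ?_
        obtain ⟨a, b, c⟩ := hRS k hk
        rw [Real.rpow_inv_natCast_pow (hX0 k hk).le hN, ← div_eq_mul_inv, div_le_iff₀ (hX0 k hk)]
        rcases min_cases (p k) (q k) with h | h <;> rw [h.1]
        · calc R k = p k * (R k / p k) := by field_simp
            _ ≤ _ := mul_le_mul_of_nonneg_left (le_max_left _ _) b.le
        · calc R k = q k * (R k / q k) := by field_simp
            _ ≤ _ := mul_le_mul_of_nonneg_left (le_max_right _ _) c.le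
    _ ≤ ∑ k, min (p k) (q k) :=
        Finset.sum_le_sum_of_subset_of_nonneg (Finset.subset_univ _)
          fun k _ _ => le_min (hp k) (hq k)

/-- The converse part of the Chernoff bound for adaptively chosen pairs of distributions. -/
theorem exists_le_sum_min {K : Set (κ → ℝ)} (hK : IsCompact K) (hK0 : ∀ P ∈ K, ∀ k, 0 ≤ P k)
    {z δ : ℝ} (hδ : 0 < δ)
    (h : ∀ P ∈ K, ∀ Q ∈ K, ∀ s ∈ Set.Icc (0 : ℝ) 1, Real.exp (-z) ≤ chernoffSum s P Q) :
    ∃ c : ℝ, 0 < c ∧ ∀ (n : ℕ) (p q : (Fin n → κ) → ℝ), IsAdapted K n p → IsAdapted K n q →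
      c * Real.exp (-(n * (z + δ))) ≤ ∑ k, min (p k) (q k) := by
  obtain ⟨u, hu, H⟩ := exists_forall_moment_le hK hδ h
  -- The exponent is `t = 1 / N ≤ u`. It depends only on `K`, `z` and `δ`, so the constant `2 ^
  -- (-N)` is independent of `n`.
  obtain ⟨N, hN⟩ := exists_nat_gt u⁻¹
  have hN0 : (0 : ℝ) < N := (inv_pos.mpr hu).trans hN
  have hN1 : N ≠ 0 := by exact_mod_cast hN0.ne'
  refine ⟨(2 ^ N)⁻¹, by positivity, fun n p q hp hq => ?_⟩
  obtain ⟨R, hR0, hR1, hRs, hRp, hRq⟩ := IsAdapted.exists_intermediate hK0 (Real.exp_pos _).le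
    (H ((N : ℝ)⁻¹) (inv_pos.mpr hN0) (inv_le_of_inv_le₀ hu hN.le)) hp hq
  refine le_trans (le_of_eq ?_) (le_sum_min_of_moment_le (hp.nonneg hK0) (hq.nonneg hK0) hR0 hR1
    hRs hN1 hRp hRq)
  rw [mul_pow, mul_inv, ← Real.exp_nat_mul, ← Real.exp_nat_mul, ← Real.exp_neg]
  congr 3
  field_simp

end Adapted

/-! ### Conditional states after measuring the first subsystem -/

section Reduction

variable {ι : Type*} [Fintype ι]

/-- The partial trace over the first subsystem of `(A ⊗ 1) X`. -/
def traceFirst {n : ℕ} (A : Matrix ι ι ℂ) (X : Matrix (Fin (n + 1) → ι) (Fin (n + 1) → ι) ℂ) :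
    Matrix (Fin n → ι) (Fin n → ι) ℂ :=
  Matrix.of fun z w => ∑ x, ∑ y, A x y * X (Fin.cons y z) (Fin.cons x w)

/-- The reduced state of the first subsystem. -/
def DensityMatrix.first {n : ℕ} (ρ : DensityMatrix (Fin (n + 1) → ι)) : DensityMatrix ι where
  mat := ∑ z : Fin n → ι, ρ.mat.submatrix (fun x => Fin.cons x z) (fun x => Fin.cons x z)
  posSemidef := Matrix.posSemidef_sum _ fun _ _ => ρ.posSemidef.submatrix _
  trace_eq_one := by
    rw [← ρ.trace_eq_one, Matrix.trace_sum, Finset.sum_congr rfl fun z _ => rfl]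
    simp only [Matrix.trace, Matrix.diag, Matrix.submatrix_apply]
    rw [Finset.sum_comm, sum_fin_succ_arrow]

theorem trace_traceFirst {n : ℕ} (A : Matrix ι ι ℂ) (ρ : DensityMatrix (Fin (n + 1) → ι)) :
    (traceFirst A ρ.mat).trace = (A * ρ.first.mat).trace := by
  simp only [traceFirst, DensityMatrix.first, Matrix.trace, Matrix.diag, Matrix.mul_apply,
    Matrix.of_apply, Matrix.sum_apply, Matrix.submatrix_apply, Finset.mul_sum]
  rw [Finset.sum_comm]
  exact Finset.sum_congr rfl fun x _ => Finset.sum_comm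

/-- Measuring one factor leaves an unnormalized state on the others; this drives the induction on
the number of subsystems. -/
theorem trace_tensorOp_mul {n : ℕ} (A : Fin (n + 1) → Matrix ι ι ℂ)
    (X : Matrix (Fin (n + 1) → ι) (Fin (n + 1) → ι) ℂ) :
    (tensorOp A * X).trace =
      (tensorOp (fun i : Fin n => A i.succ) * traceFirst (A 0) X).trace := by
  simp only [traceFirst, tensorOp, Matrix.trace, Matrix.diag, Matrix.mul_apply, Matrix.of_apply,
    sum_fin_succ_arrow, Fin.prod_univ_succ, Fin.cons_zero, Fin.cons_succ, Finset.mul_sum]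
  rw [Finset.sum_comm]
  refine Finset.sum_congr rfl fun z _ => ?_
  rw [Finset.sum_congr rfl fun x _ => Finset.sum_comm, Finset.sum_comm]
  refine Finset.sum_congr rfl fun w _ => Finset.sum_congr rfl fun x _ =>
    Finset.sum_congr rfl fun y _ => by ring

/-- The identity channel. -/
def Channel.id : Channel ι ι where
  toLin := LinearMap.id
  completelyPositive _ _ hX := hX
  tracePreserving _ := rfl

end Reduction

/-! ### Quantum outcome distributions are adapted -/

section Quantum

variable {ι κ : Type*} [Fintype ι] [DecidableEq ι] [Fintype κ]

open scoped MatrixOrder Matrix.Norms.L2Operator in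
theorem exists_eq_conjTranspose_mul_self {A : Matrix ι ι ℂ} (hA : A.PosSemidef) :
    ∃ B : Matrix ι ι ℂ, A = Bᴴ * B :=
  CStarAlgebra.nonneg_iff_eq_star_mul_self.mp (Matrix.nonneg_iff_posSemidef.mpr hA)

theorem trace_mul_nonneg {A X : Matrix ι ι ℂ} (hA : A.PosSemidef) (hX : X.PosSemidef) :
    0 ≤ (A * X).trace := by
  obtain ⟨B, rfl⟩ := exists_eq_conjTranspose_mul_self hA
  rw [Matrix.mul_assoc, Matrix.trace_mul_comm]
  exact (hX.mul_mul_conjTranspose_same B).trace_nonneg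

theorem POVM.prob_nonneg (E : POVM ι κ) (ρ : DensityMatrix ι) (k : κ) : 0 ≤ E.prob ρ k :=
  (Complex.nonneg_iff.mp (trace_mul_nonneg (E.posSemidef k) ρ.posSemidef)).1

theorem POVM.ofReal_prob (E : POVM ι κ) (ρ : DensityMatrix ι) (k : κ) :
    (E.prob ρ k : ℂ) = (E.elem k * ρ.mat).trace :=
  Complex.ext rfl (Complex.nonneg_iff.mp (trace_mul_nonneg (E.posSemidef k) ρ.posSemidef)).2

/-- States are the matrices `Bᴴ * B` with `B` on the Frobenius unit sphere, so the range is a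
continuous image of a compact set. -/
theorem isCompact_range_prob (E : POVM ι κ) : IsCompact (Set.range E.prob) := by
  have hcont : Continuous fun B : Matrix ι ι ℂ => (Bᴴ * B).trace :=
    (continuous_id.matrix_conjTranspose.matrix_mul continuous_id).matrix_trace
  have hcl : IsClosed {B : Matrix ι ι ℂ | (Bᴴ * B).trace = 1} :=
    isClosed_eq hcont continuous_const
  have hc : IsCompact {B : Matrix ι ι ℂ | (Bᴴ * B).trace = 1} := by
    refine IsCompact.of_isClosed_subset
      (isCompact_univ_pi fun _ : ι => isCompact_univ_pi fun _ : ι =>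
        isCompact_closedBall (0 : ℂ) 1) hcl ?_
    intro B hB i _ j _
    have h1 : (∑ a, ∑ b, ‖B b a‖ ^ 2 : ℝ) = 1 := by
      have h2 : (Bᴴ * B).trace = ((∑ a, ∑ b, ‖B b a‖ ^ 2 : ℝ) : ℂ) := by
        simp only [Matrix.trace, Matrix.diag, Matrix.mul_apply, Matrix.conjTranspose_apply]
        push_cast
        refine Finset.sum_congr rfl fun a _ => Finset.sum_congr rfl fun b _ => ?_
        exact RCLike.conj_mul (B b a)
      rw [Set.mem_ofPred_eq, h2] at hB
      exact_mod_cast hB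
    have h3 : ‖B i j‖ ^ 2 ≤ 1 := by
      rw [← h1]
      exact (Finset.single_le_sum (f := fun b => ‖B b j‖ ^ 2) (fun _ _ => by positivity)
        (Finset.mem_univ i)).trans (Finset.single_le_sum (f := fun a => ∑ b, ‖B b a‖ ^ 2)
          (fun _ _ => by positivity) (Finset.mem_univ j))
    simpa using (sq_le_one_iff₀ (norm_nonneg _)).mp h3
  have himg : Set.range E.prob =
      (fun (B : Matrix ι ι ℂ) (k : κ) => (E.elem k * (Bᴴ * B)).trace.re) ''
        {B : Matrix ι ι ℂ | (Bᴴ * B).trace = 1} := by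
    ext P
    constructor
    · rintro ⟨ρ, rfl⟩
      obtain ⟨B, hB⟩ := exists_eq_conjTranspose_mul_self ρ.posSemidef
      refine ⟨B, ?_, ?_⟩
      · rw [Set.mem_ofPred_eq, ← hB, ρ.trace_eq_one]
      · funext k
        rw [POVM.prob, hB]
    · rintro ⟨B, hB, rfl⟩
      exact ⟨⟨Bᴴ * B, Matrix.posSemidef_conjTranspose_mul_self B, hB⟩, rfl⟩
  rw [himg]
  refine hc.image (continuous_pi fun k => Complex.continuous_re.comp ?_)
  exact (continuous_const.matrix_mul
    (continuous_id.matrix_conjTranspose.matrix_mul continuous_id)).matrix_trace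

/-- Probability of the outcome sequence `k` in the `n`-partite state `ρ`. -/
noncomputable def seqProb (E : POVM ι κ) {n : ℕ} (ρ : DensityMatrix (Fin n → ι))
    (k : Fin n → κ) : ℝ :=
  (tensorOp (fun i => E.elem (k i)) * ρ.mat).trace.re

theorem seqProb_nonneg (E : POVM ι κ) {n : ℕ} (ρ : DensityMatrix (Fin n → ι))
    (k : Fin n → κ) : 0 ≤ seqProb E ρ k :=
  (Complex.nonneg_iff.mp
    (trace_mul_nonneg (tensorOp_posSemidef fun i => E.posSemidef (k i)) ρ.posSemidef)).1

theorem seqProb_tensorPow (E : POVM ι κ) (ρ : DensityMatrix ι) (n : ℕ) (k : Fin n → κ) :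
    seqProb E (ρ.tensorPow n) k = ∏ i, E.prob ρ (k i) := by
  rw [seqProb, DensityMatrix.tensorPow, tensorOp_mul, tensorOp_trace]
  simp only [← POVM.ofReal_prob]
  rw [← Complex.ofReal_prod, Complex.ofReal_re]

/-- With `A = Bᴴ * B` the map has a Kraus form, whose `j`-th operator contracts the first factor
with row `j` of `B`. -/
theorem traceFirst_posSemidef {n : ℕ} {A : Matrix ι ι ℂ}
    {X : Matrix (Fin (n + 1) → ι) (Fin (n + 1) → ι) ℂ} (hA : A.PosSemidef) (hX : X.PosSemidef) :
    (traceFirst A X).PosSemidef := by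
  obtain ⟨B, rfl⟩ := exists_eq_conjTranspose_mul_self hA
  have key : traceFirst (Bᴴ * B) X = ∑ j, (Matrix.of fun (z : Fin n → ι) (u : Fin (n + 1) → ι) =>
      if Fin.tail u = z then B j (u 0) else 0) * X *
      (Matrix.of fun (z : Fin n → ι) (u : Fin (n + 1) → ι) =>
        if Fin.tail u = z then B j (u 0) else 0)ᴴ := by
    ext z w
    simp only [traceFirst, Matrix.of_apply, Matrix.sum_apply, Matrix.mul_apply,
      Matrix.conjTranspose_apply, sum_fin_succ_arrow, Fin.tail_cons, Fin.cons_zero, apply_ite star,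
      star_zero, mul_ite, ite_mul, mul_zero, zero_mul, Finset.sum_ite_eq', Finset.mem_univ,
      if_true, Finset.sum_mul]
    rw [Finset.sum_congr rfl fun x _ => Finset.sum_comm, Finset.sum_comm]
    exact Finset.sum_congr rfl fun j _ => Finset.sum_congr rfl fun x _ =>
      Finset.sum_congr rfl fun y _ => by ring
  rw [key]
  exact Matrix.posSemidef_sum _ fun j _ => hX.mul_mul_conjTranspose_same _

/-- A general `n`-partite state acts like an adaptive choice of conditional states. -/
theorem isAdapted_seqProb (E : POVM ι κ) :
    ∀ {n : ℕ} (ρ : DensityMatrix (Fin n → ι)), IsAdapted (Set.range E.prob) n (seqProb E ρ)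
  | 0, ρ => by
    intro k
    have h : tensorOp (fun i => E.elem (k i)) = 1 := by
      ext x y
      rw [Subsingleton.elim x y, Matrix.one_apply_eq]
      simp [tensorOp]
    rw [seqProb, h, one_mul, ρ.trace_eq_one, Complex.one_re]
  | n + 1, ρ => by
    refine ⟨_, ⟨ρ.first, rfl⟩, ?_⟩
    suffices H : ∀ k, ∃ τ : DensityMatrix (Fin n → ι),
        traceFirst (E.elem k) ρ.mat = (E.prob ρ.first k : ℂ) • τ.mat by
      choose τ hτ using H
      refine ⟨fun k => seqProb E (τ k), fun k => ⟨isAdapted_seqProb E (τ k), fun h => ?_⟩⟩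
      rw [seqProb, trace_tensorOp_mul]
      simp only [Fin.cons_zero, Fin.cons_succ, hτ, Matrix.mul_smul, Matrix.trace_smul, smul_eq_mul,
        Complex.re_ofReal_mul, seqProb]
    intro k
    have hpsd := traceFirst_posSemidef (E.posSemidef k) ρ.posSemidef
    have htr : (traceFirst (E.elem k) ρ.mat).trace = (E.prob ρ.first k : ℂ) := by
      rw [trace_traceFirst, POVM.ofReal_prob]
    -- For an outcome of probability zero the conditional operator is positive semidefinite with
    -- trace zero, hence zero, so any state would do; the reduced state of the remaining factors is
    -- used.
    by_cases h0 : E.prob ρ.first k = 0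
    · refine ⟨⟨traceFirst 1 ρ.mat, traceFirst_posSemidef Matrix.PosSemidef.one ρ.posSemidef, ?_⟩,
        ?_⟩
      · rw [trace_traceFirst, one_mul, ρ.first.trace_eq_one]
      · rw [h0, Complex.ofReal_zero] at htr
        rw [h0, Complex.ofReal_zero, zero_smul, hpsd.trace_eq_zero_iff.mp htr]
    · have h0' : (E.prob ρ.first k : ℂ) ≠ 0 := by exact_mod_cast h0
      refine ⟨⟨(E.prob ρ.first k : ℂ)⁻¹ • traceFirst (E.elem k) ρ.mat, hpsd.smul ?_, ?_⟩, ?_⟩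
      · rw [← Complex.ofReal_inv]
        exact_mod_cast inv_nonneg.mpr (E.prob_nonneg _ _)
      · rw [Matrix.trace_smul, htr, smul_eq_mul, inv_mul_cancel₀ h0']
      · rw [smul_smul, mul_inv_cancel₀ h0', one_smul]

/-- Fixing the first outcome leaves a protocol one step shorter, and a channel output is again a
state. -/
theorem isAdapted_adaptiveProb (E : POVM ι κ) :
    ∀ {n : ℕ} (Φ : Feedback κ n (Channel ι ι)) (ρ : Feedback κ n (DensityMatrix ι)),
      IsAdapted (Set.range E.prob) n (adaptiveProb E Φ ρ)
  | 0, Φ, ρ => fun k => by simp [adaptiveProb]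
  | n + 1, Φ, ρ => by
    refine ⟨_, ⟨(Φ 0 Fin.elim0).apply (ρ 0 Fin.elim0), rfl⟩, fun k =>
      adaptiveProb E (fun s h => Φ s.succ (Fin.cons (α := fun _ => κ) k h))
        (fun s h => ρ s.succ (Fin.cons (α := fun _ => κ) k h)),
      fun k => ⟨isAdapted_adaptiveProb E _ _, fun h => ?_⟩⟩
    simp only [adaptiveProb]
    rw [Fin.prod_univ_succ, Fin.cons_zero]
    have h0 : (fun i : Fin ((0 : Fin (n + 1)) : ℕ) => (Fin.cons k h : Fin (n + 1) → κ)
        (i.castLE (0 : Fin (n + 1)).isLt.le)) = Fin.elim0 := funext fun i => i.elim0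
    have hs : ∀ s : Fin n, (fun i : Fin (s.succ : ℕ) => (Fin.cons k h : Fin (n + 1) → κ)
        (i.castLE s.succ.isLt.le)) =
        Fin.cons (α := fun _ => κ) k (fun i : Fin s => h (i.castLE s.isLt.le)) := by
      intro s
      funext i
      refine Fin.cases ?_ (fun j => ?_) i <;> rfl
    simp only [h0, hs, Fin.cons_succ]

theorem adaptiveProb_const (E : POVM ι κ) (ρ : DensityMatrix ι) {n : ℕ} (k : Fin n → κ) :
    adaptiveProb E (fun _ _ => Channel.id) (fun _ _ => ρ) k = ∏ i, E.prob ρ (k i) := rfl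

instance : Nonempty (Channel ι ι) := ⟨Channel.id⟩

instance [Nonempty ι] : Nonempty (DensityMatrix ι) := by
  classical
  obtain ⟨i⟩ := ‹Nonempty ι›
  refine ⟨⟨Matrix.diagonal (Pi.single i 1), Matrix.PosSemidef.diagonal fun j => ?_, ?_⟩⟩
  · by_cases h : j = i
    · subst h; simp
    · simp [h]
  · simp [Matrix.trace_diagonal]

end Quantum

/-! ### Overlap as optimal error, and the Chernoff upper bound -/

section Errors

variable {τ κ : Type*} [Fintype τ] [DecidableEq τ] [Fintype κ]

theorem sum_min_le (p q : τ → ℝ) (a : Finset τ) :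
    ∑ k, min (p k) (q k) ≤ ∑ k ∈ aᶜ, p k + ∑ k ∈ a, q k := by
  rw [← Finset.sum_compl_add_sum a]
  exact add_le_add (Finset.sum_le_sum fun k _ => min_le_left _ _)
    (Finset.sum_le_sum fun k _ => min_le_right _ _)

/-- The maximum likelihood decision attains the bound of `sum_min_le`. -/
theorem exists_sum_min_eq (p q : τ → ℝ) :
    ∃ a : Finset τ, ∑ k ∈ aᶜ, p k + ∑ k ∈ a, q k = ∑ k, min (p k) (q k) := by
  refine ⟨Finset.univ.filter fun k => q k ≤ p k, ?_⟩
  rw [← Finset.sum_compl_add_sum (Finset.univ.filter fun k => q k ≤ p k)]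
  congr 1
  · refine Finset.sum_congr rfl fun k hk => (min_eq_left ?_).symm
    simp only [Finset.compl_filter, Finset.mem_filter, not_le] at hk
    exact hk.2.le
  · exact Finset.sum_congr rfl fun k hk => (min_eq_right (Finset.mem_filter.mp hk).2).symm

theorem chernoffSum_nonneg (s : ℝ) (P Q : κ → ℝ) : 0 ≤ chernoffSum s P Q :=
  Finset.sum_nonneg fun k hk => by
    obtain ⟨hP, hQ⟩ := (Finset.mem_filter.mp hk).2
    positivity

theorem min_le_rpow_mul_rpow {a b s : ℝ} (ha : 0 < a) (hb : 0 < b) (hs : s ∈ Set.Icc (0 : ℝ) 1) :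
    min a b ≤ a ^ s * b ^ (1 - s) := by
  have hm : 0 < min a b := lt_min ha hb
  calc min a b = min a b ^ s * min a b ^ (1 - s) := by
        rw [← Real.rpow_add hm, add_sub_cancel, Real.rpow_one]
    _ ≤ a ^ s * b ^ (1 - s) := mul_le_mul
        (Real.rpow_le_rpow hm.le (min_le_left _ _) hs.1)
        (Real.rpow_le_rpow hm.le (min_le_right _ _) (sub_nonneg.mpr hs.2))
        (Real.rpow_nonneg hm.le _) (Real.rpow_nonneg ha.le _)

/-- The Chernoff upper bound for product distributions. -/
theorem sum_min_prod_le {P Q : κ → ℝ} (hP : ∀ k, 0 ≤ P k) (hQ : ∀ k, 0 ≤ Q k) {s : ℝ}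
    (hs : s ∈ Set.Icc (0 : ℝ) 1) (n : ℕ) :
    ∑ k : Fin n → κ, min (∏ i, P (k i)) (∏ i, Q (k i)) ≤ chernoffSum s P Q ^ n := by
  classical
  have hpow : chernoffSum s P Q ^ n = ∑ k : Fin n → κ, ∏ i,
      (if 0 < P (k i) ∧ 0 < Q (k i) then P (k i) ^ s * Q (k i) ^ (1 - s) else 0) := by
    rw [chernoffSum, Finset.sum_filter, Finset.sum_pow']
    simp
  rw [hpow]
  refine Finset.sum_le_sum fun k _ => ?_
  by_cases h : ∀ i, 0 < P (k i) ∧ 0 < Q (k i)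
  · simp only [h, and_self, if_true, Finset.prod_mul_distrib]
    rw [Real.finsetProd_rpow _ _ fun i _ => hP _, Real.finsetProd_rpow _ _ fun i _ => hQ _]
    exact min_le_rpow_mul_rpow (Finset.prod_pos fun i _ => (h i).1)
      (Finset.prod_pos fun i _ => (h i).2) hs
  -- A vanishing factor annihilates one of the two products, so the minimum is zero.
  · obtain ⟨i, hi⟩ := not_forall.mp h
    refine le_trans (le_of_eq ?_) (Finset.prod_nonneg fun i _ => ?_)
    · rcases not_and_or.mp hi with hi | hi
      · rw [Finset.prod_eq_zero (Finset.mem_univ i) ((not_lt.mp hi).antisymm (hP _))]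
        exact min_eq_left (Finset.prod_nonneg fun i _ => hQ _)
      · rw [Finset.prod_eq_zero (f := fun i => Q (k i)) (Finset.mem_univ i)
          ((not_lt.mp hi).antisymm (hQ _))]
        exact min_eq_right (Finset.prod_nonneg fun i _ => hP _)
    · split_ifs with h
      · exact (mul_pos (Real.rpow_pos_of_pos h.1 _) (Real.rpow_pos_of_pos h.2 _)).le
      · exact le_rfl

/-- Each term is continuous where both probabilities are positive, and elsewhere it takes its least
value zero. Full continuity can fail at `s = 0` and `s = 1`, but a minimum on a compact set needs
only this. -/
theorem lowerSemicontinuous_chernoffSum :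
    LowerSemicontinuous fun x : ((κ → ℝ) × (κ → ℝ)) × ℝ => chernoffSum x.2 x.1.1 x.1.2 := by
  classical
  simp only [chernoffSum, Finset.sum_filter]
  refine lowerSemicontinuous_sum fun k _ => ?_
  rintro ⟨⟨P, Q⟩, s⟩
  have cP : ContinuousAt (fun x : ((κ → ℝ) × (κ → ℝ)) × ℝ => x.1.1 k) ((P, Q), s) := by fun_prop
  have cQ : ContinuousAt (fun x : ((κ → ℝ) × (κ → ℝ)) × ℝ => x.1.2 k) ((P, Q), s) := by fun_prop
  have cs : ContinuousAt (fun x : ((κ → ℝ) × (κ → ℝ)) × ℝ => x.2) ((P, Q), s) := by fun_prop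
  by_cases h : 0 < P k ∧ 0 < Q k
  · refine ContinuousAt.lowerSemicontinuousAt ?_
    have hc : ContinuousAt (fun x : ((κ → ℝ) × (κ → ℝ)) × ℝ =>
        x.1.1 k ^ x.2 * x.1.2 k ^ (1 - x.2)) ((P, Q), s) :=
      (cP.rpow cs (Or.inl h.1.ne')).mul (cQ.rpow (continuousAt_const.sub cs) (Or.inl h.2.ne'))
    refine hc.congr ?_
    filter_upwards [cP.eventually (lt_mem_nhds h.1), cQ.eventually (lt_mem_nhds h.2)] with x h1 h2
    rw [if_pos ⟨h1, h2⟩]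
  · intro y hy
    simp only [if_neg h] at hy
    refine Eventually.of_forall fun x => hy.trans_le ?_
    dsimp only
    split_ifs with h
    · exact (mul_pos (Real.rpow_pos_of_pos h.1 _) (Real.rpow_pos_of_pos h.2 _)).le
    · exact le_rfl

end Errors

/-! ### From exponential bounds to rates in `EReal` -/

section Rates

theorem elog_mono : Monotone elog := fun _ _ h =>
  ENNReal.log_monotone (ENNReal.ofReal_le_ofReal h)

theorem elog_of_pos {x : ℝ} (hx : 0 < x) : elog x = (Real.log x : EReal) :=
  ENNReal.log_ofReal_of_pos hx

theorem elog_of_nonpos {x : ℝ} (hx : x ≤ 0) : elog x = ⊥ := by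
  rw [elog, ENNReal.log_ofReal, if_pos hx]

/-- Exponential upper and lower bounds on a sequence determine its rate. -/
theorem tendsto_elog_div {x : ℕ → ℝ} {f : ℝ} (hf : 0 ≤ f) (hupper : ∀ n, x n ≤ f ^ n)
    (hlower : ∀ z, f = Real.exp (-z) → ∀ δ > 0, ∃ c > 0, ∀ n : ℕ,
      c * Real.exp (-(n * (z + δ))) ≤ x n) :
    Tendsto (fun n : ℕ => elog (x n) / (n : EReal)) atTop (𝓝 (elog f)) := by
  rcases hf.eq_or_lt with rfl | hf
  · refine tendsto_const_nhds.congr' ?_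
    filter_upwards [eventually_gt_atTop 0] with n hn
    rw [elog_of_nonpos le_rfl,
      elog_of_nonpos ((hupper n).trans_eq (zero_pow hn.ne')), EReal.bot_div_of_pos_ne_top]
    · exact_mod_cast hn
    · exact EReal.natCast_ne_top n
  · set z := -Real.log f with hz
    have hfz : f = Real.exp (-z) := by rw [hz, neg_neg, Real.exp_log hf]
    have hx0 : ∀ n, 0 < x n := fun n => by
      obtain ⟨c, hc, h⟩ := hlower z hfz 1 one_pos
      exact (mul_pos hc (Real.exp_pos _)).trans_le (h n)
    have hreal : Tendsto (fun n : ℕ => Real.log (x n) / n) atTop (𝓝 (Real.log f)) := by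
      refine tendsto_order.mpr ⟨fun y hy => ?_, fun y hy => ?_⟩
      · obtain ⟨δ, hδ, hyδ⟩ : ∃ δ > 0, y = Real.log f - 2 * δ :=
          ⟨(Real.log f - y) / 2, by linarith, by ring⟩
        obtain ⟨c, hc, h⟩ := hlower z hfz δ hδ
        have hlim : Tendsto (fun n : ℕ => Real.log c / n) atTop (𝓝 0) :=
          tendsto_const_div_atTop_nhds_zero_nat _
        filter_upwards [hlim.eventually (lt_mem_nhds (neg_lt_zero.mpr hδ)),
          eventually_gt_atTop 0] with n h1 hn
        have hn' : (0 : ℝ) < n := by exact_mod_cast hn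
        have h2 := Real.log_le_log (by positivity) (h n)
        rw [Real.log_mul hc.ne' (Real.exp_pos _).ne', Real.log_exp] at h2
        rw [lt_div_iff₀ hn'] at h1 ⊢
        rw [hyδ]
        linarith
      · filter_upwards [eventually_gt_atTop 0] with n hn
        have hn' : (0 : ℝ) < n := by exact_mod_cast hn
        have h2 := Real.log_le_log (hx0 n) (hupper n)
        rw [Real.log_pow] at h2
        refine lt_of_le_of_lt ?_ hy
        rwa [div_le_iff₀ hn', mul_comm]
    rw [elog_of_pos hf]
    refine ((continuous_coe_real_ereal.tendsto _).comp hreal).congr fun n => ?_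
    rw [Function.comp_apply, elog_of_pos (hx0 n), EReal.coe_div]
    rfl

theorem elog_injOn : Set.InjOn elog (Set.Ici 0) := by
  intro x hx y hy h
  exact (ENNReal.ofReal_eq_ofReal_iff hx hy).mp (ENNReal.log_injective h)

end Rates

section Bounds

variable {ι κ : Type*} [Fintype ι] [DecidableEq ι] [Fintype κ]

theorem adaptiveProb_nonneg (E : POVM ι κ) {n : ℕ} (Φ : Feedback κ n (Channel ι ι))
    (ρ : Feedback κ n (DensityMatrix ι)) (k : Fin n → κ) : 0 ≤ adaptiveProb E Φ ρ k :=
  Finset.prod_nonneg fun _ _ => E.prob_nonneg _ _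

theorem exists_min_chernoffSum [Nonempty ι] (E : POVM ι κ) :
    ∃ ρ σ : DensityMatrix ι, ∃ s ∈ Set.Icc (0 : ℝ) 1, ∀ ρ' σ' : DensityMatrix ι,
      ∀ s' ∈ Set.Icc (0 : ℝ) 1,
        chernoffSum s (E.prob ρ) (E.prob σ) ≤ chernoffSum s' (E.prob ρ') (E.prob σ') := by
  have hK := isCompact_range_prob E
  obtain ⟨⟨⟨_, _⟩, s⟩, ⟨⟨⟨ρ, rfl⟩, ⟨σ, rfl⟩⟩, hs⟩, hmin⟩ :=
    (lowerSemicontinuous_chernoffSum (κ := κ)).lowerSemicontinuousOn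
      ((Set.range E.prob ×ˢ Set.range E.prob) ×ˢ Set.Icc (0 : ℝ) 1) |>.exists_isMinOn
      (((Set.range_nonempty _).prod (Set.range_nonempty _)).prod ⟨0, by simp⟩)
      ((hK.prod hK).prod isCompact_Icc)
  exact ⟨ρ, σ, s, hs, fun ρ' σ' s' hs' =>
    hmin (a := ((E.prob ρ', E.prob σ'), s')) ⟨⟨⟨ρ', rfl⟩, ⟨σ', rfl⟩⟩, hs'⟩⟩

/-- The overlap of two adapted distributions is at least the optimal Chernoff rate allows. -/
theorem exists_le_sum_min_of_le (E : POVM ι κ) {f : ℝ}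
    (hf : ∀ ρ σ : DensityMatrix ι, ∀ s ∈ Set.Icc (0 : ℝ) 1,
      f ≤ chernoffSum s (E.prob ρ) (E.prob σ)) {z : ℝ} (hz : f = Real.exp (-z)) {δ : ℝ}
    (hδ : 0 < δ) :
    ∃ c : ℝ, 0 < c ∧ ∀ (n : ℕ) (p q : (Fin n → κ) → ℝ), IsAdapted (Set.range E.prob) n p →
      IsAdapted (Set.range E.prob) n q → c * Real.exp (-(n * (z + δ))) ≤ ∑ k, min (p k) (q k) := by
  refine exists_le_sum_min (isCompact_range_prob E) ?_ hδ ?_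
  · rintro _ ⟨ρ, rfl⟩ k
    exact E.prob_nonneg ρ k
  · rintro _ ⟨ρ, rfl⟩ _ ⟨σ, rfl⟩ s hs
    exact hz ▸ hf ρ σ s hs

theorem half_le_of_le {a b : ℝ} (hb : 0 ≤ b) (h : a ≤ b) : a / 2 ≤ b := by linarith

/-- Every error between the adaptive converse and the i.i.d. error has the same rate. -/
theorem tendsto_rate_of_bounds (E : POVM ι κ) {f : ℝ} (hf0 : 0 ≤ f)
    (hf : ∀ ρ σ : DensityMatrix ι, ∀ s ∈ Set.Icc (0 : ℝ) 1,
      f ≤ chernoffSum s (E.prob ρ) (E.prob σ)) {x : ℕ → ℝ}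
    (hlower : ∀ (n : ℕ) (b : ℝ), (∀ p q, IsAdapted (Set.range E.prob) n p →
      IsAdapted (Set.range E.prob) n q → b ≤ ∑ k, min (p k) (q k)) → b / 2 ≤ x n)
    (hupper : ∀ n, x n ≤ f ^ n) :
    Tendsto (fun n : ℕ => elog (x n) / (n : EReal)) atTop (𝓝 (elog f)) := by
  refine tendsto_elog_div hf0 hupper fun z hz δ hδ => ?_
  obtain ⟨c, hc, h⟩ := exists_le_sum_min_of_le E hf hz hδ
  refine ⟨c / 2, half_pos hc, fun n => ?_⟩
  rw [div_mul_eq_mul_div]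
  exact hlower n _ (h n)

end Bounds

section Main

variable {ι κ : Type*} [Fintype ι] [DecidableEq ι] [Fintype κ] [DecidableEq κ]

theorem typeIError_add_typeIIError (E : POVM ι κ) {n : ℕ} (a : Finset (Fin n → κ))
    (ρ σ : DensityMatrix (Fin n → ι)) :
    typeIError E a ρ + typeIIError E a σ = ∑ k ∈ aᶜ, seqProb E ρ k + ∑ k ∈ a, seqProb E σ k := by
  simp only [typeIError, typeIIError, POVM.grouping, Finset.sum_mul, Matrix.trace_sum,
    Complex.re_sum, seqProb]

theorem le_pErr (E : POVM ι κ) {n : ℕ} (ρ σ : DensityMatrix (Fin n → ι)) :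
    (∑ k, min (seqProb E ρ k) (seqProb E σ k)) / 2 ≤ pErr E ρ σ := by
  refine le_ciInf fun a => ?_
  rw [typeIError_add_typeIIError]
  have := sum_min_le (seqProb E ρ) (seqProb E σ) a
  linarith

theorem pErr_le (E : POVM ι κ) {n : ℕ} (ρ σ : DensityMatrix (Fin n → ι)) :
    pErr E ρ σ ≤ (∑ k, min (seqProb E ρ k) (seqProb E σ k)) / 2 := by
  obtain ⟨a, ha⟩ := exists_sum_min_eq (seqProb E ρ) (seqProb E σ)
  rw [← ha, ← typeIError_add_typeIIError]
  exact ciInf_le (Set.finite_range _).bddBelow a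

theorem pErr_nonneg (E : POVM ι κ) {n : ℕ} (ρ σ : DensityMatrix (Fin n → ι)) :
    0 ≤ pErr E ρ σ :=
  le_trans (div_nonneg (Finset.sum_nonneg fun _ _ => le_min (seqProb_nonneg E _ _)
    (seqProb_nonneg E _ _)) zero_le_two) (le_pErr E ρ σ)

theorem pErrPre_le_pErr (E : POVM ι κ) {n : ℕ} (ρ σ : DensityMatrix (Fin n → ι)) :
    pErrPre E ρ σ ≤ pErr E ρ σ :=
  ciInf_le ⟨0, by rintro _ ⟨Φ, rfl⟩; exact pErr_nonneg _ _ _⟩ Channel.id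

theorem pErrPre_nonneg (E : POVM ι κ) {n : ℕ} (ρ σ : DensityMatrix (Fin n → ι)) :
    0 ≤ pErrPre E ρ σ :=
  le_ciInf fun _ => pErr_nonneg _ _ _

theorem pErrOpt_le_pErrPre (E : POVM ι κ) {n : ℕ} (ρ σ : DensityMatrix (Fin n → ι)) :
    pErrOpt E n ≤ pErrPre E ρ σ :=
  ciInf_le (f := fun p : DensityMatrix (Fin n → ι) × DensityMatrix (Fin n → ι) =>
    pErrPre E p.1 p.2) ⟨0, by rintro _ ⟨p, rfl⟩; exact pErrPre_nonneg _ _ _⟩ (ρ, σ)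

theorem adaptiveErrOpt_le (E : POVM ι κ) {n : ℕ} (Φ : Feedback κ n (Channel ι ι))
    (ρ σ : Feedback κ n (DensityMatrix ι)) :
    adaptiveErrOpt E n ≤ (∑ k, min (adaptiveProb E Φ ρ k) (adaptiveProb E Φ σ k)) / 2 := by
  obtain ⟨a, ha⟩ := exists_sum_min_eq (adaptiveProb E Φ ρ) (adaptiveProb E Φ σ)
  rw [← ha]
  refine ciInf_le (f := fun p : (Feedback κ n (DensityMatrix ι) × Feedback κ n (DensityMatrix ι)) ×
      Feedback κ n (Channel ι ι) × Finset (Fin n → κ) => adaptiveErr E p.2.1 p.1.1 p.1.2 p.2.2)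
    ⟨0, ?_⟩ ((ρ, σ), Φ, a)
  rintro _ ⟨p, rfl⟩
  exact div_nonneg (add_nonneg (Finset.sum_nonneg fun _ _ => adaptiveProb_nonneg _ _ _ _)
    (Finset.sum_nonneg fun _ _ => adaptiveProb_nonneg _ _ _ _)) zero_le_two

theorem le_pErrPre (E : POVM ι κ) {n : ℕ} {b : ℝ}
    (h : ∀ p q, IsAdapted (Set.range E.prob) n p → IsAdapted (Set.range E.prob) n q →
      b ≤ ∑ k, min (p k) (q k)) (ρ σ : DensityMatrix (Fin n → ι)) :
    b / 2 ≤ pErrPre E ρ σ :=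
  le_ciInf fun _ => (div_le_div_of_nonneg_right (h _ _ (isAdapted_seqProb E _)
    (isAdapted_seqProb E _)) zero_le_two).trans (le_pErr E _ _)

theorem le_adaptiveErrOpt [Nonempty ι] (E : POVM ι κ) {n : ℕ} {b : ℝ}
    (h : ∀ p q, IsAdapted (Set.range E.prob) n p → IsAdapted (Set.range E.prob) n q →
      b ≤ ∑ k, min (p k) (q k)) : b / 2 ≤ adaptiveErrOpt E n := by
  have : Nonempty (Feedback κ n (DensityMatrix ι)) := ⟨fun _ _ => Classical.arbitrary _⟩
  have : Nonempty (Feedback κ n (Channel ι ι)) := ⟨fun _ _ => Classical.arbitrary _⟩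
  exact le_ciInf fun p => div_le_div_of_nonneg_right
    ((h _ _ (isAdapted_adaptiveProb E p.2.1 p.1.1) (isAdapted_adaptiveProb E p.2.1 p.1.2)).trans
      (sum_min_le _ _ _)) zero_le_two

theorem pErr_tensorPow_le (E : POVM ι κ) (ρ σ : DensityMatrix ι) {s : ℝ}
    (hs : s ∈ Set.Icc (0 : ℝ) 1) (n : ℕ) :
    pErr E (ρ.tensorPow n) (σ.tensorPow n) ≤ chernoffSum s (E.prob ρ) (E.prob σ) ^ n := by
  refine (pErr_le E _ _).trans (half_le_of_le (pow_nonneg (chernoffSum_nonneg _ _ _) n) ?_)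
  simp only [seqProb_tensorPow]
  exact sum_min_prod_le (E.prob_nonneg ρ) (E.prob_nonneg σ) hs n

theorem adaptiveErrOpt_le_pow (E : POVM ι κ) (ρ σ : DensityMatrix ι) {s : ℝ}
    (hs : s ∈ Set.Icc (0 : ℝ) 1) (n : ℕ) :
    adaptiveErrOpt E n ≤ chernoffSum s (E.prob ρ) (E.prob σ) ^ n := by
  refine (adaptiveErrOpt_le E (fun _ _ => Channel.id) (fun _ _ => ρ) (fun _ _ => σ)).trans
    (half_le_of_le (pow_nonneg (chernoffSum_nonneg _ _ _) n) ?_)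
  simp only [adaptiveProb_const]
  exact sum_min_prod_le (E.prob_nonneg ρ) (E.prob_nonneg σ) hs n

end Main

end DetectorDiscrimination

theorem mainTheorem1 {d m : ℕ} (hd : 0 < d) (E : POVM (Fin d) (Fin m)) :
    -- the double minimum in the definition of `ζ_CB` is attained
    IsLeast (chernoffValues E) (-zetaCB E) ∧
    -- exponent of the error minimized over input pairs, pre-processing and post-processing
    Tendsto (fun n : ℕ => -(elog (pErrOpt E n) / (n : EReal))) atTop (𝓝 (zetaCB E)) ∧
    -- minimization of the asymptotic rate over sequences of input pairs
    IsLeast {r : EReal | ∃ ρ σ : (n : ℕ) → DensityMatrix (Fin n → Fin d),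
        Tendsto (fun n : ℕ => elog (pErrPre E (ρ n) (σ n)) / (n : EReal)) atTop (𝓝 r)}
      (-zetaCB E) ∧
    -- every minimizing pair is asymptotically optimal as an i.i.d. input, without pre-processing
    (∀ ρ σ : DensityMatrix (Fin d),
      (∃ s ∈ Set.Icc (0 : ℝ) 1, phi s (E.prob ρ) (E.prob σ) = -zetaCB E) →
      Tendsto (fun n : ℕ => -(elog (pErr E (ρ.tensorPow n) (σ.tensorPow n)) / (n : EReal)))
        atTop (𝓝 (zetaCB E))) ∧
    -- adaptive protocols have the same optimal exponent
    Tendsto (fun n : ℕ => -(elog (adaptiveErrOpt E n) / (n : EReal))) atTop (𝓝 (zetaCB E)) := by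
  have : Nonempty (Fin d) := ⟨⟨0, hd⟩⟩
  obtain ⟨ρ₀, σ₀, s₀, hs₀, hmin⟩ := exists_min_chernoffSum E
  set f := chernoffSum s₀ (E.prob ρ₀) (E.prob σ₀) with hf
  have hf0 : 0 ≤ f := chernoffSum_nonneg _ _ _
  have hleast : IsLeast (chernoffValues E) (elog f) := by
    refine ⟨⟨ρ₀, σ₀, s₀, hs₀, rfl⟩, ?_⟩
    rintro _ ⟨ρ, σ, s, hs, rfl⟩
    exact elog_mono (hmin ρ σ s hs)
  have hζ : zetaCB E = -elog f := by rw [zetaCB, hleast.csInf_eq]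
  have hneg : -zetaCB E = elog f := by rw [hζ, neg_neg]
  have hopt : Tendsto (fun n : ℕ => elog (pErrOpt E n) / (n : EReal)) atTop (𝓝 (elog f)) :=
    tendsto_rate_of_bounds E hf0 hmin
      (fun n b h => le_ciInf fun p => le_pErrPre E h p.1 p.2)
      (fun n => (pErrOpt_le_pErrPre E _ _).trans
        ((pErrPre_le_pErr E _ _).trans (pErr_tensorPow_le E ρ₀ σ₀ hs₀ n)))
  refine ⟨hneg ▸ hleast, ?_, ?_, ?_, ?_⟩
  · rw [hζ]
    exact hopt.neg
  · rw [hneg]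
    refine ⟨⟨ρ₀.tensorPow, σ₀.tensorPow, tendsto_rate_of_bounds E hf0 hmin
      (fun n b h => le_pErrPre E h _ _)
      (fun n => (pErrPre_le_pErr E _ _).trans (pErr_tensorPow_le E ρ₀ σ₀ hs₀ n))⟩, ?_⟩
    rintro r ⟨ρ, σ, hr⟩
    refine le_of_tendsto_of_tendsto' hopt hr fun n => ?_
    exact EReal.div_le_div_right_of_nonneg (by positivity)
      (elog_mono (pErrOpt_le_pErrPre E _ _))
  · rintro ρ σ ⟨s, hs, hphi⟩
    rw [hζ]
    refine Tendsto.neg (tendsto_rate_of_bounds E hf0 hmin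
      (fun n b h => (le_pErrPre E h _ _).trans (pErrPre_le_pErr E _ _)) fun n => ?_)
    have : chernoffSum s (E.prob ρ) (E.prob σ) = f :=
      elog_injOn (chernoffSum_nonneg _ _ _) hf0 (hphi.trans hneg)
    exact this ▸ pErr_tensorPow_le E ρ σ hs n
  · rw [hζ]
    exact Tendsto.neg (tendsto_rate_of_bounds E hf0 hmin
      (fun n b h => le_adaptiveErrOpt E h) (adaptiveErrOpt_le_pow E ρ₀ σ₀ hs₀))
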